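/- Let $m$ be normalized Lebesgue measure on the unit circle $\mathbb T$, and identify functions that agree $m$-almost everywhere. Let $\alpha$ be a continuous rotationally symmetric norm, that is, a norm on the complex vector space $L^\infty=L^\infty(\mathbb T,m)$ such that $\alpha(1)=1$; $\alpha(|f|)=\alpha(f)$ for all $f\in L^\infty$; $\alpha(f_w)=\alpha(f)$ for all $f\in L^\infty$ and $w\in\mathbb T$, where $f_w(z)=f(\overline w z)$; and $\alpha(\chi_E)\to 0$ as $m(E)\to 0^+$. Extend $\alpha$ to all measurable $f:\mathbb T\to\mathbb C$ by $\alpha(f)=\sup\{\alpha(s): s \text{ simple},\ 0\le s\le |f|\}\in[0,\infty]$, and write $[S]_\alpha$ for the $\alpha$-closure of $S \subseteq L^\infty$, i.e. the set of measurable $f$ such that for every $\varepsilon>0$ there is $g\in S$ with $\alpha(f-g)<\varepsilon$. Let $H^\infty=\{f\in L^\infty:\int_{\mathbb T} f z^{-k}\,dm=0\text{ for all integers }k<0\}$ and $H^\alpha=[H^\infty]_\alpha$. For an integer $n\ge 1$ let $H^\infty(z^n)=\{f(z^n): f\in H^\infty\}$ and $M_\alpha(z^n)=[H^\infty(z^n)]_\alpha$.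 Then $$H^\alpha = M_\alpha(z^n)\oplus zM_\alpha(z^n)\oplus\cdots\oplus z^{n-1}M_\alpha(z^n)$$ as an algebraic direct sum of complex linear subspaces: the subspaces $z^kM_\alpha(z^n)$, $0\le k\le n-1$, are linearly independent and their sum is $H^\alpha$. -/

import Mathlib

open MeasureTheory
open scoped ENNReal NNReal

noncomputable section

namespace RotHardy

/-- The Borel σ-algebra on the unit circle `𝕋 ⊆ ℂ`. -/
instance instMeasurableSpaceCircle : MeasurableSpace Circle := borel Circle

instance instBorelSpaceCircle : BorelSpace Circle := ⟨rfl⟩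

/-- Normalized Lebesgue measure on the unit circle: its Haar measure of total mass `1`. -/
def m : Measure Circle := Measure.haarMeasure ⊤

instance instIsHaarMeasure : m.IsHaarMeasure := by unfold m; infer_instance

instance instIsProbabilityMeasure : IsProbabilityMeasure m :=
  ⟨by simpa [m] using Measure.haarMeasure_self (K₀ := (⊤ : TopologicalSpace.PositiveCompacts Circle))⟩

/-- Measurable functions `𝕋 → ℂ`, modulo equality almost everywhere. -/
abbrev L0 := Circle →ₘ[m] ℂ

/-- The space `L^∞` on the unit circle. -/
abbrev Linf := Lp ℂ ∞ m

/-- The `k`-th Fourier coefficient `∫ f z^{-k} dm`. -/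
def coeff (f : Circle → ℂ) (k : ℤ) : ℂ := ∫ z, f z * (z : ℂ) ^ (-k) ∂m

/-- The rotation `f_w(z) = f(w̄ z)`; on the circle `w̄ = w⁻¹`. -/
def rot (w : Circle) (f : Linf) : Linf :=
  Lp.compMeasurePreserving (fun z => w⁻¹ * z) (measurePreserving_mul_left m w⁻¹) f

lemma memLp_abs (f : Linf) : MemLp (fun z => ((‖f z‖ : ℝ) : ℂ)) ∞ m :=
  (Lp.memLp f).norm.ofReal

/-- The modulus `|f|` as an element of `L^∞`. -/
def absLinf (f : Linf) : Linf := (memLp_abs f).toLp _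

/-- The characteristic function `χ_E` as an element of `L^∞`. -/
def chi (E : Set Circle) (hE : MeasurableSet E) : Linf :=
  indicatorConstLp ∞ hE (measure_ne_top m E) (1 : ℂ)

/-- A norm `α` on `L^∞` with `α(1) = 1` and `α(|f|) = α(f)`. -/
structure GaugeNorm extends Seminorm ℂ Linf where
  eq_zero' : ∀ f : Linf, toFun f = 0 → f = 0
  map_one' : toFun (Lp.const ∞ m (1 : ℂ)) = 1
  map_abs' : ∀ f : Linf, toFun (absLinf f) = toFun f

namespace GaugeNorm

instance : CoeFun GaugeNorm (fun _ => Linf → ℝ) := ⟨fun α => α.toSeminorm⟩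

variable (α : GaugeNorm)

/-- `α` is rotationally symmetric: `α(f_w) = α(f)` for all `w ∈ 𝕋`. (The other two requirements,
`α(1) = 1` and `α(|f|) = α(f)`, are part of `GaugeNorm`.) -/
def IsRotSymm : Prop := ∀ (w : Circle) (f : Linf), α (rot w f) = α f

/-- `α` is continuous: `α(χ_E) → 0` as `m(E) → 0⁺`. -/
def IsCont : Prop :=
  ∀ ε : ℝ, 0 < ε → ∃ δ : ℝ≥0∞, 0 < δ ∧
    ∀ (E : Set Circle) (hE : MeasurableSet E), 0 < m E → m E < δ → α (chi E hE) < ε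

end GaugeNorm

/-- `s` is (the class of) a simple function with `0 ≤ s ≤ |f|`. -/
def IsSimpleBelow (s : Linf) (f : L0) : Prop :=
  ∃ φ : SimpleFunc Circle ℝ≥0,
    (∀ᵐ z ∂m, s z = ((φ z : ℝ) : ℂ)) ∧ ∀ᵐ z ∂m, (φ z : ℝ) ≤ ‖f z‖

namespace GaugeNorm

variable (α : GaugeNorm)

/-- The extension of `α` to all measurable functions,
`α(f) = sup {α(s) : s simple, 0 ≤ s ≤ |f|} ∈ [0, ∞]`. -/
def ext (f : L0) : ℝ≥0∞ :=
  ⨆ (s : Linf) (_ : IsSimpleBelow s f), ENNReal.ofReal (α s)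

lemma one_eq : α (Lp.const ∞ m (1 : ℂ)) = 1 := α.map_one'

lemma abs_eq (f : Linf) : α (absLinf f) = α f := α.map_abs' f

lemma congr_norm {f g : Linf} (h : ∀ᵐ z ∂m, ‖f z‖ = ‖g z‖) : α f = α g := by
  rw [← α.abs_eq f, ← α.abs_eq g]
  congr 1
  unfold absLinf
  rw [MemLp.toLp_eq_toLp_iff]
  filter_upwards [h] with z hz
  rw [hz]

lemma mono {f g : Linf} (h : ∀ᵐ z ∂m, ‖f z‖ ≤ ‖g z‖) : α f ≤ α g := by
  have key : ∀ e : ℝ, MemLp (fun z => ((‖g z‖ : ℝ) : ℂ) *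
      Complex.exp (((e * Real.arccos (‖f z‖ / ‖g z‖) : ℝ) : ℂ) * Complex.I)) ∞ m := by
    intro e
    refine (Lp.memLp g).norm.mono ?_ ?_
    · have hf := (Lp.aestronglyMeasurable f).norm.aemeasurable
      have hg := (Lp.aestronglyMeasurable g).norm.aemeasurable
      have h1 : AEMeasurable (fun z => e * Real.arccos (‖f z‖ / ‖g z‖)) m :=
        (Real.measurable_arccos.comp_aemeasurable (hf.div hg)).const_mul e
      exact ((Complex.measurable_ofReal.comp_aemeasurable hg).mul
        (Complex.measurable_exp.comp_aemeasurable
          ((Complex.measurable_ofReal.comp_aemeasurable h1).mul_const _))).aestronglyMeasurable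
    · filter_upwards with z
      rw [norm_mul, Complex.norm_exp_ofReal_mul_I]
      simp
  have hval : ∀ e : ℝ, α ((key e).toLp _) = α g := by
    intro e
    apply α.congr_norm
    filter_upwards [(key e).coeFn_toLp] with z hz
    rw [hz, norm_mul, Complex.norm_exp_ofReal_mul_I]
    simp
  have hf : absLinf f = (1 / 2 : ℂ) • ((key 1).toLp _ + (key (-1)).toLp _) := by
    apply Lp.ext
    filter_upwards [(memLp_abs f).coeFn_toLp, (key 1).coeFn_toLp, (key (-1)).coeFn_toLp,
      Lp.coeFn_smul (1 / 2 : ℂ) ((key 1).toLp _ + (key (-1)).toLp _),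
      Lp.coeFn_add ((key 1).toLp _) ((key (-1)).toLp _), h] with z h0 h1 h2 h3 h4 h5
    unfold absLinf
    rw [h0, h3, Pi.smul_apply, h4, Pi.add_apply, h1, h2, ← mul_add, smul_eq_mul]
    have hc : Complex.exp (((1 * Real.arccos (‖f z‖ / ‖g z‖) : ℝ) : ℂ) * Complex.I) +
        Complex.exp (((-1 * Real.arccos (‖f z‖ / ‖g z‖) : ℝ) : ℂ) * Complex.I) =
        2 * ((‖f z‖ / ‖g z‖ : ℝ) : ℂ) := by
      have h6 : ‖f z‖ / ‖g z‖ ≤ 1 := div_le_one_of_le₀ h5 (norm_nonneg _)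
      have h7 : -1 ≤ ‖f z‖ / ‖g z‖ := le_trans (by norm_num) (by positivity : 0 ≤ ‖f z‖ / ‖g z‖)
      conv_rhs => rw [← Real.cos_arccos h7 h6]
      rw [Complex.ofReal_cos, Complex.two_cos]
      push_cast
      ring_nf
    rw [hc]
    by_cases hg : ‖g z‖ = 0
    · have : ‖f z‖ = 0 := le_antisymm (hg ▸ h5) (norm_nonneg _)
      simp [hg, this]
    · have hg' : ((‖g z‖ : ℝ) : ℂ) ≠ 0 := by exact_mod_cast hg
      push_cast
      field_simp
  rw [← α.abs_eq f, hf, map_smul_eq_mul]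
  have := map_add_le_add α.toSeminorm ((key 1).toLp _) ((key (-1)).toLp _)
  rw [hval, hval] at this
  have h2 : ‖(1 / 2 : ℂ)‖ = 1 / 2 := by norm_num
  rw [h2]
  linarith

lemma le_of_bound {f : Linf} {C : ℝ} (hC : 0 ≤ C) (h : ∀ᵐ z ∂m, ‖f z‖ ≤ C) : α f ≤ C := by
  have h1 : α f ≤ α ((C : ℂ) • Lp.const ∞ m (1 : ℂ)) := by
    apply α.mono
    filter_upwards [h, Lp.coeFn_smul (C : ℂ) (Lp.const ∞ m (1 : ℂ)),
      Lp.coeFn_const ∞ m (1 : ℂ)] with z hz h2 h3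
    rw [h2, Pi.smul_apply, h3]
    simpa [abs_of_nonneg hC] using hz
  rw [map_smul_eq_mul, α.one_eq] at h1
  simpa [abs_of_nonneg hC] using h1

lemma le_ext {u : Linf} {f : L0} (h : ∀ᵐ z ∂m, ‖u z‖ ≤ ‖f z‖) :
    ENNReal.ofReal (α u) ≤ α.ext f := by
  refine ENNReal.le_of_forall_pos_le_add fun ε hε _ => ?_
  have hε' : (0 : ℝ) < ε := hε
  have hmeas : Measurable fun z => ‖u z‖ := (Lp.stronglyMeasurable u).measurable.norm
  obtain ⟨C, hC⟩ : ∃ C : ℝ, ∀ᵐ z ∂m, ‖u z‖ ≤ C := by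
    refine ⟨‖u‖, ?_⟩
    filter_upwards [ae_le_eLpNormEssSup (f := u) (μ := m)] with z hz
    have hfin := (Lp.eLpNorm_lt_top u).ne
    rw [Lp.norm_def, ← toReal_enorm]
    exact ENNReal.toReal_mono hfin (by rwa [eLpNorm_exponent_top])
  let N : SimpleFunc Circle ℕ :=
    { toFun := fun z => min ⌊‖u z‖ / ε⌋₊ ⌊C / ε⌋₊
      measurableSet_fiber' := fun k => by
        have : Measurable fun z => min ⌊‖u z‖ / (ε : ℝ)⌋₊ ⌊C / ε⌋₊ :=
          (hmeas.div_const _).nat_floor.min measurable_const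
        exact this (measurableSet_singleton k)
      finite_range' := by
        refine (Set.finite_Iic ⌊C / (ε : ℝ)⌋₊).subset ?_
        rintro _ ⟨z, rfl⟩
        exact Nat.min_le_right _ _ }
  let φ : SimpleFunc Circle ℝ≥0 := N.map fun k : ℕ => ε * (k : ℝ≥0)
  have hs : MemLp (fun z => ((φ z : ℝ) : ℂ)) ∞ m :=
    (φ.map fun x : ℝ≥0 => ((x : ℝ) : ℂ)).memLp_top m
  have hφ : ∀ᵐ z ∂m, (φ z : ℝ) ≤ ‖u z‖ ∧ ‖u z‖ - φ z ≤ ε := by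
    filter_upwards [hC] with z hz
    have h1 : φ z = ε * (⌊‖u z‖ / ε⌋₊ : ℝ≥0) := by
      change ε * ((min ⌊‖u z‖ / (ε : ℝ)⌋₊ ⌊C / ε⌋₊ : ℕ) : ℝ≥0) = _
      rw [min_eq_left (Nat.floor_mono (by gcongr))]
    have h2 : (⌊‖u z‖ / (ε : ℝ)⌋₊ : ℝ) ≤ ‖u z‖ / ε := Nat.floor_le (by positivity)
    have h3 : ‖u z‖ / ε < (⌊‖u z‖ / (ε : ℝ)⌋₊ : ℝ) + 1 := Nat.lt_floor_add_one _
    rw [le_div_iff₀ hε'] at h2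
    rw [div_lt_iff₀ hε'] at h3
    rw [h1]
    push_cast
    constructor <;> nlinarith
  have hsim : IsSimpleBelow (hs.toLp _) f := by
    refine ⟨φ, hs.coeFn_toLp, ?_⟩
    filter_upwards [hφ, h] with z h1 h2
    exact h1.1.trans h2
  have hdiff : α (absLinf u - hs.toLp _) ≤ ε := by
    refine α.le_of_bound hε'.le ?_
    filter_upwards [hφ, Lp.coeFn_sub (absLinf u) (hs.toLp _), (memLp_abs u).coeFn_toLp,
      hs.coeFn_toLp] with z h1 h2 h3 h4
    rw [h2, Pi.sub_apply, h4]
    unfold absLinf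
    rw [h3, ← Complex.ofReal_sub, Complex.norm_real, Real.norm_eq_abs,
      abs_of_nonneg (by linarith [h1.1])]
    exact h1.2
  have htri : α u ≤ α (hs.toLp _) + ε := by
    have h1 := map_add_le_add α.toSeminorm (hs.toLp _) (absLinf u - hs.toLp _)
    rw [add_sub_cancel, α.abs_eq] at h1
    linarith
  calc ENNReal.ofReal (α u) ≤ ENNReal.ofReal (α (hs.toLp _) + ε) := ENNReal.ofReal_le_ofReal htri
    _ ≤ ENNReal.ofReal (α (hs.toLp _)) + ENNReal.ofReal ε := ENNReal.ofReal_add_le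
    _ ≤ α.ext f + ε := by
      rw [ENNReal.ofReal_coe_nnreal]
      gcongr
      exact le_iSup₂_of_le (hs.toLp _) hsim le_rfl

lemma ext_mono {f g : L0} (h : ∀ᵐ z ∂m, ‖f z‖ ≤ ‖g z‖) : α.ext f ≤ α.ext g := by
  refine iSup₂_le fun s ⟨φ, h1, h2⟩ => α.le_ext ?_
  filter_upwards [h, h1, h2] with z h3 h4 h5
  rw [h4, Complex.norm_real, Real.norm_eq_abs, abs_of_nonneg (φ z).coe_nonneg]
  exact h5.trans h3

lemma ext_add_le (f g : L0) : α.ext (f + g) ≤ α.ext f + α.ext g := by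
  refine iSup₂_le fun s ⟨φ, h1, h2⟩ => ?_
  have key : ∀ p q : L0, MemLp (fun z => ((φ z * (‖p z‖ / (‖p z‖ + ‖q z‖)) : ℝ) : ℂ)) ∞ m := by
    intro p q
    refine ((φ.map fun x : ℝ≥0 => ((x : ℝ) : ℂ)).memLp_top m).mono ?_ ?_
    · have hp := p.stronglyMeasurable.measurable.norm
      have hq := q.stronglyMeasurable.measurable.norm
      exact (Complex.measurable_ofReal.comp (φ.measurable.coe_nnreal_real.mul
        (hp.div (hp.add hq)))).aestronglyMeasurable
    · filter_upwards with z
      have h3 : ‖p z‖ / (‖p z‖ + ‖q z‖) ≤ 1 :=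
        div_le_one_of_le₀ (by linarith [norm_nonneg (q z)]) (by positivity)
      rw [Complex.norm_real, Real.norm_eq_abs, abs_of_nonneg (by positivity)]
      simpa using mul_le_of_le_one_right (φ z).2 h3
  have hle : ∀ p q : L0, (∀ᵐ z ∂m, (φ z : ℝ) ≤ ‖p z‖ + ‖q z‖) →
      ENNReal.ofReal (α ((key p q).toLp _)) ≤ α.ext p := by
    intro p q hpq
    refine α.le_ext ?_
    filter_upwards [(key p q).coeFn_toLp, hpq] with z hz h4
    rw [hz, Complex.norm_real, Real.norm_eq_abs, abs_of_nonneg (by positivity), ← mul_div_assoc]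
    refine div_le_of_le_mul₀ (by positivity) (norm_nonneg _) ?_
    nlinarith [norm_nonneg (p z)]
  have hfg : ∀ᵐ z ∂m, (φ z : ℝ) ≤ ‖f z‖ + ‖g z‖ := by
    filter_upwards [h2, AEEqFun.coeFn_add f g] with z h3 h4
    rw [h4] at h3
    exact h3.trans (norm_add_le _ _)
  have hs : s = (key f g).toLp _ + (key g f).toLp _ := by
    apply Lp.ext
    filter_upwards [h1, hfg, (key f g).coeFn_toLp, (key g f).coeFn_toLp,
      Lp.coeFn_add ((key f g).toLp _) ((key g f).toLp _)] with z h3 h4 h5 h6 h7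
    rw [h7, Pi.add_apply, h5, h6, h3, ← Complex.ofReal_add, ← mul_add, add_comm ‖g z‖, ← add_div]
    by_cases h0 : ‖f z‖ + ‖g z‖ = 0
    · have : (φ z : ℝ) = 0 := le_antisymm (h0 ▸ h4) (φ z).2
      simp [this]
    · rw [div_self h0, mul_one]
  rw [hs]
  calc _ ≤ ENNReal.ofReal (α ((key f g).toLp _) + α ((key g f).toLp _)) :=
        ENNReal.ofReal_le_ofReal (map_add_le_add α.toSeminorm _ _)
    _ ≤ ENNReal.ofReal (α ((key f g).toLp _)) + ENNReal.ofReal (α ((key g f).toLp _)) :=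
        ENNReal.ofReal_add_le
    _ ≤ _ := add_le_add (hle f g hfg) (hle g f (by simpa only [add_comm] using hfg))

lemma ext_zero : α.ext 0 = 0 := by
  refine le_antisymm (iSup₂_le fun s ⟨φ, h1, h2⟩ => ?_) bot_le
  have : s = 0 := by
    apply Lp.ext
    filter_upwards [h1, h2, AEEqFun.coeFn_zero (α := Circle) (β := ℂ) (μ := m),
      Lp.coeFn_zero ℂ ∞ m] with z h3 h4 h5 h6
    rw [h5] at h4
    have : (φ z : ℝ) = 0 := le_antisymm (by simpa using h4) (φ z).2
    rw [h3, h6, this]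
    simp
  rw [this, map_zero]
  simp

lemma ext_smul_le (c : ℂ) (f : L0) : α.ext (c • f) ≤ ENNReal.ofReal ‖c‖ * α.ext f := by
  refine iSup₂_le fun s ⟨φ, h1, h2⟩ => ?_
  by_cases hc : c = 0
  · have h3 : IsSimpleBelow s 0 := ⟨φ, h1, by
      have h0 : (0 : ℂ) • f = 0 := zero_smul ℂ f
      rwa [hc, h0] at h2⟩
    have h4 : ENNReal.ofReal (α s) ≤ α.ext 0 := le_iSup₂_of_le s h3 le_rfl
    rw [α.ext_zero] at h4
    exact h4.trans bot_le
  · have h3 : α s = ‖c‖ * α (c⁻¹ • s) := by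
      rw [← map_smul_eq_mul, smul_inv_smul₀ hc]
    rw [h3, ENNReal.ofReal_mul (norm_nonneg _)]
    gcongr
    refine α.le_ext ?_
    filter_upwards [h1, h2, Lp.coeFn_smul c⁻¹ s, AEEqFun.coeFn_smul c f] with z h4 h5 h6 h7
    have h8 : ‖((φ z : ℝ) : ℂ)‖ = φ z := by simp
    have hc' : 0 < ‖c‖ := norm_pos_iff.2 hc
    rw [h7, Pi.smul_apply, norm_smul] at h5
    rw [h6, Pi.smul_apply, norm_smul, h4, h8, norm_inv, inv_mul_le_iff₀ hc']
    exact h5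

/-- The `α`-closure of a subspace `S` of `L^∞`: the measurable functions `f` for which there are
`g ∈ S` with `α(f - g)` arbitrarily small. (Such `f` have `α(f) < ∞` by the triangle inequality.) -/
def closure (S : Submodule ℂ Linf) : Submodule ℂ L0 where
  carrier := {f | ∀ ε : ℝ≥0∞, 0 < ε → ∃ g ∈ S, α.ext (f - (g : L0)) < ε}
  zero_mem' := fun ε hε => ⟨0, S.zero_mem, by simpa [α.ext_zero] using hε⟩
  add_mem' := by
    intro f₁ f₂ h₁ h₂ ε hε
    obtain ⟨g₁, hg₁, h₁⟩ := h₁ (ε / 2) (ENNReal.half_pos hε.ne')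
    obtain ⟨g₂, hg₂, h₂⟩ := h₂ (ε / 2) (ENNReal.half_pos hε.ne')
    refine ⟨g₁ + g₂, S.add_mem hg₁ hg₂, ?_⟩
    have h3 : f₁ + f₂ - ((g₁ + g₂ : Linf) : L0) = (f₁ - (g₁ : L0)) + (f₂ - (g₂ : L0)) := by
      rw [AddSubgroup.coe_add]
      abel
    rw [h3]
    calc _ ≤ _ := α.ext_add_le _ _
      _ < ε / 2 + ε / 2 := ENNReal.add_lt_add h₁ h₂
      _ = ε := ENNReal.add_halves ε
  smul_mem' := by
    intro c f hf ε hε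
    have hd : ENNReal.ofReal ‖c‖ + 1 ≠ 0 := by simp
    have ht : ENNReal.ofReal ‖c‖ + 1 ≠ ∞ := by simp
    obtain ⟨δ, hδ, hδ'⟩ : ∃ δ : ℝ≥0∞, 0 < δ ∧ ENNReal.ofReal ‖c‖ * δ < ε := by
      by_cases he : ε = ∞
      · exact ⟨1, one_pos, by simp [he]⟩
      · refine ⟨ε / 2 / (ENNReal.ofReal ‖c‖ + 1),
          ENNReal.div_pos (ENNReal.half_pos hε.ne').ne' ht, ?_⟩
        calc _ ≤ (ENNReal.ofReal ‖c‖ + 1) * (ε / 2 / (ENNReal.ofReal ‖c‖ + 1)) := by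
              gcongr
              exact le_self_add
          _ = ε / 2 := ENNReal.mul_div_cancel hd ht
          _ < ε := ENNReal.half_lt_self hε.ne' he
    obtain ⟨g, hg, h⟩ := hf δ hδ
    refine ⟨c • g, S.smul_mem c hg, ?_⟩
    have h3 : c • f - ((c • g : Linf) : L0) = c • (f - (g : L0)) := by
      rw [smul_sub]
      rfl
    rw [h3]
    calc _ ≤ _ := α.ext_smul_le _ _
      _ ≤ ENNReal.ofReal ‖c‖ * δ := by gcongr
      _ < ε := hδ'

end GaugeNorm

lemma integrable_mul_zpow (f : Linf) (k : ℤ) : Integrable (fun z => f z * (z : ℂ) ^ k) m := by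
  have h1 : Integrable (fun z => f z) m := (Lp.memLp f).integrable le_top
  refine h1.mono (h1.1.mul ?_) ?_
  · have : Continuous fun z : Circle => ((z ^ k : Circle) : ℂ) :=
      continuous_subtype_val.comp (continuous_zpow k)
    simp only [Circle.coe_zpow] at this
    exact this.aestronglyMeasurable
  · filter_upwards with z
    rw [norm_mul, norm_zpow, Circle.norm_coe, one_zpow, mul_one]

/-- `H^∞`: the functions in `L^∞` whose negative Fourier coefficients vanish. -/
def Hinf : Submodule ℂ Linf where
  carrier := {f | ∀ k : ℤ, k < 0 → coeff f k = 0}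
  zero_mem' := by
    intro k _
    unfold coeff
    rw [integral_congr_ae (g := fun _ => 0), integral_zero]
    filter_upwards [Lp.coeFn_zero ℂ ∞ m] with z hz
    rw [hz, Pi.zero_apply, zero_mul]
  add_mem' := by
    intro f g hf hg k hk
    have h1 := hf k hk
    have h2 := hg k hk
    unfold coeff at *
    rw [integral_congr_ae (g := fun z => f z * (z : ℂ) ^ (-k) + g z * (z : ℂ) ^ (-k)),
      integral_add (integrable_mul_zpow f _) (integrable_mul_zpow g _), h1, h2, add_zero]
    filter_upwards [Lp.coeFn_add f g] with z hz
    simp only [hz, Pi.add_apply, add_mul]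
  smul_mem' := by
    intro c f hf k hk
    have h1 := hf k hk
    unfold coeff at *
    rw [integral_congr_ae (g := fun z => c * (f z * (z : ℂ) ^ (-k))), integral_const_mul, h1,
      mul_zero]
    filter_upwards [Lp.coeFn_smul c f] with z hz
    simp only [hz, Pi.smul_apply, smul_eq_mul, mul_assoc]

lemma measurePreserving_pow (n : ℕ) [NeZero n] :
    MeasurePreserving (fun z : Circle => z ^ n) m m := by
  refine (powMonoidHom n : Circle →* Circle).measurePreserving (continuous_pow n) ?_ rfl
  intro z
  refine ⟨Circle.exp (Complex.arg z / n), ?_⟩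
  have hn : (n : ℝ) ≠ 0 := Nat.cast_ne_zero.2 (NeZero.ne n)
  rw [powMonoidHom_apply, ← Circle.exp_nsmul, nsmul_eq_mul, mul_div_cancel₀ _ hn, Circle.exp_arg]

/-- `H^∞(z^n) = {f(z^n) : f ∈ H^∞}`. -/
def HinfPow (n : ℕ) [NeZero n] : Submodule ℂ Linf :=
  Hinf.map (Lp.compMeasurePreservingₗ ℂ (fun z : Circle => z ^ n) (measurePreserving_pow n))

/-- The Hardy space `H^α`, the `α`-closure of `H^∞`. -/
def Halpha (α : GaugeNorm) : Submodule ℂ L0 := α.closure Hinf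

/-- `M_α(z^n)`, the `α`-closure of `H^∞(z^n)`. -/
def Malpha (α : GaugeNorm) (n : ℕ) [NeZero n] : Submodule ℂ L0 := α.closure (HinfPow n)

/-- The function `z ↦ z^k` on the circle. -/
def zPow (k : ℕ) : L0 :=
  AEEqFun.mk (fun z : Circle => (z : ℂ) ^ k)
    (by fun_prop : Continuous fun z : Circle => (z : ℂ) ^ k).aestronglyMeasurable

/-- Multiplication by `z^k` on measurable functions. -/
def mulZ (k : ℕ) : L0 →ₗ[ℂ] L0 where
  toFun f := zPow k * f
  map_add' f g := by
    apply AEEqFun.ext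
    filter_upwards [AEEqFun.coeFn_mul (zPow k) (f + g), AEEqFun.coeFn_mul (zPow k) f,
      AEEqFun.coeFn_mul (zPow k) g, AEEqFun.coeFn_add f g,
      AEEqFun.coeFn_add (zPow k * f) (zPow k * g)] with z h1 h2 h3 h4 h5
    simp only [h1, h2, h3, h4, h5, Pi.add_apply, Pi.mul_apply, mul_add]
  map_smul' c f := by
    apply AEEqFun.ext
    filter_upwards [AEEqFun.coeFn_mul (zPow k) (c • f), AEEqFun.coeFn_mul (zPow k) f,
      AEEqFun.coeFn_smul c f, AEEqFun.coeFn_smul c (zPow k * f)] with z h1 h2 h3 h4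
    simp only [h1, h2, h3, h4, Pi.smul_apply, Pi.mul_apply, smul_eq_mul, RingHom.id_apply]
    ring

end RotHardy

end

noncomputable section

namespace RotHardy

/-! The decomposition is Fourier analysis on the group of `n`-th roots of unity. Let ω = e^{2πi/n},
let R be the rotation f ↦ f(ω ·), and let A be the average of the powers R^j, 0 ≤ j < n. By
rotational symmetry R, and hence A, does not increase the extended norm; multiplication by z^k does
not either.

Independence: elements of H^∞(z^n) are fixed by R, and so are their α-limits
(`rotL_eq_of_mem_Malpha`). Hence z^k M_α(z^n) lies in the eigenspace of R for ω^k, and these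
eigenvalues are distinct for 0 ≤ k < n.

Sum: every measurable f equals ∑ z^k A(z^{-k} f) (`sum_zC_mul_avg`). By contractivity it is enough
that A(z^{-k} g) ∈ H^∞(z^n) for g ∈ H^∞ (`exists_mem_HinfPow_eq_avg`). This average is ω-invariant,
hence of the form h(z^n), and the l-th coefficient of h is the (nl + k)-th coefficient of g, which
vanishes for l < 0 because k < n. The opposite inclusion comes from H^∞(z^n) ⊆ H^∞
(`HinfPow_le_Hinf`). -/

/-! ### Rotations and definiteness of the extended norm. -/

lemma coeFn_sum {ι : Type*} (s : Finset ι) (F : ι → L0) :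
    (∑ i ∈ s, F i : L0) =ᵐ[m] fun z => ∑ i ∈ s, F i z := by
  classical
  induction s using Finset.induction_on with
  | empty =>
    simp only [Finset.sum_empty]
    exact AEEqFun.coeFn_zero
  | insert a s ha ih =>
    rw [Finset.sum_insert ha]
    filter_upwards [ih, AEEqFun.coeFn_add (F a) (∑ i ∈ s, F i)] with z h1 h2
    rw [h2, Pi.add_apply, h1, Finset.sum_insert ha]

/-- The rotation `f ↦ f(w ·)` on measurable functions. -/
def rotL (w : Circle) : L0 →ₗ[ℂ] L0 where
  toFun f := f.compMeasurePreserving (fun z => w * z) (measurePreserving_mul_left m w)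
  map_add' f g := AEEqFun.induction_on₂ f g fun _ _ _ _ => rfl
  map_smul' _ f := AEEqFun.induction_on f fun _ _ => rfl

lemma coeFn_rotL (w : Circle) (f : L0) : rotL w f =ᵐ[m] fun z => f (w * z) :=
  AEEqFun.coeFn_compMeasurePreserving f (measurePreserving_mul_left m w)

lemma ae_rot {p : Circle → Prop} (w : Circle) (h : ∀ᵐ z ∂m, p z) : ∀ᵐ z ∂m, p (w * z) :=
  (measurePreserving_mul_left m w).quasiMeasurePreserving.ae h

/-- A simple minorant of the rotated function, rotated back, is dominated by |f| and has the same α.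
-/
lemma ext_rotL_le {α : GaugeNorm} (hrot : α.IsRotSymm) (w : Circle) (f : L0) :
    α.ext (rotL w f) ≤ α.ext f := by
  refine iSup₂_le fun s ⟨φ, h1, h2⟩ => ?_
  rw [← hrot w s]
  refine α.le_ext ?_
  have h3 : rot w s =ᵐ[m] fun z => s (w⁻¹ * z) := Lp.coeFn_compMeasurePreserving _ _
  filter_upwards [h3, ae_rot w⁻¹ h1, ae_rot w⁻¹ h2, ae_rot w⁻¹ (coeFn_rotL w f)]
    with z h4 h5 h6 h7
  rw [h4, h5, Complex.norm_real, Real.norm_eq_abs, abs_of_nonneg (φ _).coe_nonneg]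
  rw [h7, mul_inv_cancel_left] at h6
  exact h6

/-- Each truncation of f to {|f| ≤ N} is bounded and dominated by f, so it vanishes by definiteness
of α on L^∞; these sets exhaust the circle. -/
lemma eq_zero_of_ext_eq_zero {α : GaugeNorm} {f : L0} (hf : α.ext f = 0) : f = 0 := by
  have key : ∀ N : ℕ, ∀ᵐ z ∂m, ‖f z‖ ≤ N → f z = 0 := by
    intro N
    have hS : MeasurableSet {z | ‖f z‖ ≤ N} :=
      measurableSet_le f.stronglyMeasurable.measurable.norm measurable_const
    have hu : MemLp (Set.indicator {z | ‖f z‖ ≤ N} f) ∞ m := by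
      refine memLp_top_of_bound (f.stronglyMeasurable.indicator hS).aestronglyMeasurable N ?_
      filter_upwards with z
      by_cases hz : z ∈ {z | ‖f z‖ ≤ (N : ℝ)}
      · rw [Set.indicator_of_mem hz]
        exact hz
      · rw [Set.indicator_of_notMem hz]
        simp
    have hle : ENNReal.ofReal (α (hu.toLp _)) ≤ α.ext f := by
      refine α.le_ext ?_
      filter_upwards [hu.coeFn_toLp] with z hz
      rw [hz]
      exact norm_indicator_le_norm_self _ _
    have h0 : hu.toLp _ = 0 := by
      refine α.eq_zero' _ (le_antisymm ?_ (apply_nonneg α.toSeminorm _))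
      rw [hf] at hle
      exact ENNReal.ofReal_eq_zero.1 (le_antisymm hle bot_le)
    have h1 := hu.coeFn_toLp
    rw [h0] at h1
    filter_upwards [h1, Lp.coeFn_zero ℂ ∞ m] with z h2 h3 h4
    rw [h3, Set.indicator_of_mem (show z ∈ {z | ‖f z‖ ≤ (N : ℝ)} from h4)] at h2
    exact h2.symm
  apply AEEqFun.ext
  filter_upwards [ae_all_iff.2 key, AEEqFun.coeFn_zero (α := Circle) (β := ℂ) (μ := m)]
    with z h1 h2
  obtain ⟨N, hN⟩ := exists_nat_ge ‖f z‖
  rw [h1 N hN, h2, Pi.zero_apply]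

/-! ### Multiplication by integer powers of z. -/

lemma continuous_zpow_coe (k : ℤ) : Continuous fun z : Circle => (z : ℂ) ^ k := by
  have : Continuous fun z : Circle => ((z ^ k : Circle) : ℂ) :=
    continuous_subtype_val.comp (continuous_zpow k)
  simpa only [Circle.coe_zpow] using this

/-- The function `z ↦ z^k` on the circle, for an integer `k`. -/
def zC (k : ℤ) : L0 := AEEqFun.mk (fun z : Circle => (z : ℂ) ^ k)
  (continuous_zpow_coe k).aestronglyMeasurable

lemma coeFn_zC_mul (k : ℤ) (f : L0) : (zC k * f : L0) =ᵐ[m] fun z => (z : ℂ) ^ k * f z := by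
  filter_upwards [AEEqFun.coeFn_mul (zC k) f,
    AEEqFun.coeFn_mk _ (continuous_zpow_coe k).aestronglyMeasurable] with z h1 h2
  rw [h1, Pi.mul_apply, zC, h2]

lemma mulZ_eq (k : ℕ) (f : L0) : mulZ k f = zC k * f := by
  have h : zPow k = zC k := by
    unfold zPow zC
    congr 1
  rw [← h]
  rfl

lemma ext_zC_mul_le (α : GaugeNorm) (k : ℤ) (f : L0) : α.ext (zC k * f) ≤ α.ext f := by
  refine α.ext_mono ?_
  filter_upwards [coeFn_zC_mul k f] with z hz
  rw [hz, norm_mul, norm_zpow, Circle.norm_coe, one_zpow, one_mul]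

/-! ### Averaging over the n-th roots of unity. -/

/-- The primitive `n`-th root of unity `e^{2πi/n}`. -/
def root (n : ℕ) : Circle := Circle.exp (2 * Real.pi / n)

lemma isPrimitiveRoot_root (n : ℕ) [NeZero n] : IsPrimitiveRoot (root n : ℂ) n := by
  convert Complex.isPrimitiveRoot_exp n (NeZero.ne n) using 1
  unfold root
  rw [Circle.coe_exp]
  congr 1
  push_cast
  ring

lemma root_pow (n : ℕ) [NeZero n] : root n ^ n = 1 := by
  apply Circle.ext
  simpa using (isPrimitiveRoot_root n).pow_eq_one

/-- The averaging operator `f ↦ n⁻¹ ∑ f(ω^j ·)` over the rotations by `n`-th roots of unity. -/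
def avg (n : ℕ) : L0 →ₗ[ℂ] L0 := (n : ℂ)⁻¹ • ∑ j ∈ Finset.range n, rotL (root n ^ j)

lemma coeFn_avg (n : ℕ) (f : L0) :
    avg n f =ᵐ[m] fun z => (n : ℂ)⁻¹ * ∑ j ∈ Finset.range n, f (root n ^ j * z) := by
  have h1 : avg n f = (n : ℂ)⁻¹ • ∑ j ∈ Finset.range n, rotL (root n ^ j) f := by
    simp [avg, LinearMap.sum_apply]
  rw [h1]
  filter_upwards [AEEqFun.coeFn_smul (n : ℂ)⁻¹ (∑ j ∈ Finset.range n, rotL (root n ^ j) f),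
    coeFn_sum (Finset.range n) fun j => rotL (root n ^ j) f,
    ae_all_iff.2 fun j => coeFn_rotL (root n ^ j) f] with z h2 h3 h4
  rw [h2, Pi.smul_apply, h3, smul_eq_mul]
  simp only [h4]

lemma ext_sum_le (α : GaugeNorm) {ι : Type*} (s : Finset ι) (F : ι → L0) :
    α.ext (∑ i ∈ s, F i) ≤ ∑ i ∈ s, α.ext (F i) := by
  classical
  induction s using Finset.induction_on with
  | empty => simp [α.ext_zero]
  | insert a s ha ih =>
    rw [Finset.sum_insert ha, Finset.sum_insert ha]
    exact (α.ext_add_le _ _).trans (by gcongr)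

lemma ext_avg_le {α : GaugeNorm} (hrot : α.IsRotSymm) (n : ℕ) [NeZero n] (f : L0) :
    α.ext (avg n f) ≤ α.ext f := by
  have h1 : avg n f = (n : ℂ)⁻¹ • ∑ j ∈ Finset.range n, rotL (root n ^ j) f := by
    simp [avg, LinearMap.sum_apply]
  have hn : (n : ℝ≥0∞) ≠ 0 := Nat.cast_ne_zero.2 (NeZero.ne n)
  rw [h1]
  calc _ ≤ ENNReal.ofReal ‖(n : ℂ)⁻¹‖ * α.ext (∑ j ∈ Finset.range n, rotL (root n ^ j) f) :=
        α.ext_smul_le _ _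
    _ ≤ ENNReal.ofReal ‖(n : ℂ)⁻¹‖ * ∑ j ∈ Finset.range n, α.ext f := by
        gcongr
        exact (ext_sum_le α _ _).trans (Finset.sum_le_sum fun j _ => ext_rotL_le hrot _ f)
    _ = α.ext f := by
        rw [Finset.sum_const, Finset.card_range, nsmul_eq_mul, norm_inv, Complex.norm_natCast,
          ENNReal.ofReal_inv_of_pos (Nat.cast_pos.2 (NeZero.pos n)), ENNReal.ofReal_natCast,
          ← mul_assoc, ENNReal.inv_mul_cancel hn (ENNReal.natCast_ne_top n), one_mul]

/-- Discrete Fourier inversion: after the two sums are exchanged, f(ω^j z) carries the factor n⁻¹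
∑_k ω^{-jk}, a geometric sum that is 1 for j = 0 and 0 otherwise. -/
lemma sum_zC_mul_avg (n : ℕ) [NeZero n] (f : L0) :
    ∑ k ∈ Finset.range n, zC k * avg n (zC (-k) * f) = f := by
  have hn : (n : ℂ) ≠ 0 := Nat.cast_ne_zero.2 (NeZero.ne n)
  apply AEEqFun.ext
  filter_upwards [coeFn_sum (Finset.range n) fun k : ℕ => zC k * avg n (zC (-k) * f),
    ae_all_iff.2 fun k : ℕ => coeFn_zC_mul k (avg n (zC (-k) * f)),
    ae_all_iff.2 fun k : ℕ => coeFn_avg n (zC (-k) * f),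
    ae_all_iff.2 fun j : ℕ => ae_all_iff.2 fun k : ℕ =>
      ae_rot (root n ^ j) (coeFn_zC_mul (-k) f)] with z h1 h2 h3 h4
  have hz : (z : ℂ) ≠ 0 := Circle.coe_ne_zero z
  have hw := isPrimitiveRoot_root n
  have hw0 : (root n : ℂ) ≠ 0 := Circle.coe_ne_zero _
  have hsum : ∀ j ∈ Finset.range n, ∑ k ∈ Finset.range n, ((root n : ℂ) ^ j)⁻¹ ^ k =
      if j = 0 then (n : ℂ) else 0 := by
    intro j hj
    split_ifs with h0
    · simp [h0]
    · have h5 : ((root n : ℂ) ^ j)⁻¹ ≠ 1 := by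
        rw [Ne, inv_eq_one]
        exact hw.pow_ne_one_of_pos_of_lt h0 (Finset.mem_range.1 hj)
      rw [geom_sum_eq h5, inv_pow, ← pow_mul, mul_comm j, pow_mul, hw.pow_eq_one]
      simp
  calc _ = ∑ k ∈ Finset.range n, ∑ j ∈ Finset.range n,
        (n : ℂ)⁻¹ * f (root n ^ j * z) * ((root n : ℂ) ^ j)⁻¹ ^ k := by
        rw [h1]
        refine Finset.sum_congr rfl fun k _ => ?_
        rw [h2, h3, Finset.mul_sum, Finset.mul_sum]
        refine Finset.sum_congr rfl fun j _ => ?_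
        rw [h4]
        push_cast
        rw [mul_zpow, zpow_neg, zpow_neg, zpow_natCast, zpow_natCast, inv_pow]
        field_simp
    _ = f z := by
        rw [Finset.sum_comm]
        simp_rw [← Finset.mul_sum]
        rw [Finset.sum_congr rfl fun j hj => by rw [hsum j hj]]
        simp only [mul_ite, mul_zero]
        rw [Finset.sum_ite_eq' (Finset.range n) 0
          fun j => (n : ℂ)⁻¹ * f (root n ^ j * z) * (n : ℂ),
          if_pos (Finset.mem_range.2 (NeZero.pos n)), pow_zero, one_mul]
        field_simp

/-! ### Fourier coefficients under rotation, z ↦ z^n and shifts. -/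

lemma coeff_congr {f g : Circle → ℂ} (h : f =ᵐ[m] g) (k : ℤ) : coeff f k = coeff g k := by
  unfold coeff
  refine integral_congr_ae ?_
  filter_upwards [h] with z hz
  rw [hz]

lemma coeff_rot (f : Circle → ℂ) (w : Circle) (k : ℤ) :
    coeff (fun z => f (w * z)) k = (w : ℂ) ^ k * coeff f k := by
  unfold coeff
  rw [← integral_mul_left_eq_self (fun z : Circle => f z * (z : ℂ) ^ (-k)) w,
    ← integral_const_mul]
  congr 1
  ext z
  have hw : (w : ℂ) ^ k ≠ 0 := zpow_ne_zero _ (Circle.coe_ne_zero w)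
  rw [Circle.coe_mul, mul_zpow, zpow_neg (w : ℂ)]
  field_simp

lemma coeff_comp_pow (n : ℕ) [NeZero n] {h : Circle → ℂ} (hh : AEStronglyMeasurable h m) (k : ℤ) :
    coeff (fun z => h (z ^ n)) (n * k) = coeff h k := by
  have hp := measurePreserving_pow n
  have hm : AEStronglyMeasurable (fun z : Circle => h z * (z : ℂ) ^ (-k))
      (m.map fun z : Circle => z ^ n) := by
    rw [hp.map_eq]
    exact hh.mul (continuous_zpow_coe _).aestronglyMeasurable
  have h1 := integral_map hp.aemeasurable hm
  rw [hp.map_eq] at h1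
  unfold coeff
  rw [h1]
  congr 1
  ext z
  rw [Circle.coe_pow, ← zpow_natCast (z : ℂ) n, ← zpow_mul, mul_neg]

lemma zC_mul_sub (k : ℤ) (f g : L0) : zC k * (f - g) = zC k * f - zC k * g := by
  apply AEEqFun.ext
  filter_upwards [coeFn_zC_mul k (f - g), coeFn_zC_mul k f, coeFn_zC_mul k g,
    AEEqFun.coeFn_sub f g, AEEqFun.coeFn_sub (zC k * f) (zC k * g)] with z h1 h2 h3 h4 h5
  rw [h1, h4, h5, Pi.sub_apply, Pi.sub_apply, h2, h3, mul_sub]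

lemma ext_sub_le (α : GaugeNorm) (f g : L0) : α.ext (f - g) ≤ α.ext f + α.ext g := by
  rw [sub_eq_add_neg]
  refine (α.ext_add_le f (-g)).trans (add_le_add le_rfl (α.ext_mono ?_))
  filter_upwards [AEEqFun.coeFn_neg g] with z hz
  rw [hz, Pi.neg_apply, norm_neg]

lemma exists_zC_mul (k : ℤ) (f : Linf) :
    ∃ v : Linf, (v : L0) = zC k * (f : L0) ∧ ∀ i, coeff v i = coeff f (i - k) := by
  have hv : MemLp (fun z : Circle => (z : ℂ) ^ k * f z) ∞ m := by
    refine (Lp.memLp f).mono ((continuous_zpow_coe k).aestronglyMeasurable.mul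
      (Lp.aestronglyMeasurable f)) ?_
    filter_upwards with z
    rw [norm_mul, norm_zpow, Circle.norm_coe, one_zpow, one_mul]
  refine ⟨hv.toLp _, ?_, fun i => ?_⟩
  · apply AEEqFun.ext
    filter_upwards [hv.coeFn_toLp, coeFn_zC_mul k (f : L0)] with z h1 h2
    rw [h2]
    exact h1
  · rw [coeff_congr hv.coeFn_toLp]
    unfold coeff
    congr 1
    ext z
    have hz : (z : ℂ) ≠ 0 := Circle.coe_ne_zero z
    rw [show -(i - k) = k + -i by ring, zpow_add₀ hz]
    ring

/-! ### The space H^∞(z^n) and ω-invariant functions. -/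

lemma coeFn_of_mem_HinfPow {n : ℕ} [NeZero n] {u : Linf} (hu : u ∈ HinfPow n) :
    ∃ h ∈ Hinf, u =ᵐ[m] fun z => h (z ^ n) := by
  obtain ⟨h, hh, rfl⟩ := hu
  exact ⟨h, hh, Lp.coeFn_compMeasurePreserving _ (measurePreserving_pow n)⟩

lemma ae_rot_root_of_mem_HinfPow {n : ℕ} [NeZero n] {u : Linf} (hu : u ∈ HinfPow n) :
    ∀ᵐ z ∂m, u (root n * z) = u z := by
  obtain ⟨h, -, huh⟩ := coeFn_of_mem_HinfPow hu
  filter_upwards [huh, ae_rot (root n) huh] with z h1 h2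
  rw [h1, h2, mul_pow, root_pow, one_mul]

/-- The coefficient of h(z^n) at nl is that of h at l. At k not divisible by n, invariance under ω
gives c_k = ω^k c_k with ω^k ≠ 1, so c_k = 0. -/
lemma HinfPow_le_Hinf (n : ℕ) [NeZero n] : HinfPow n ≤ Hinf := by
  intro u hu k hk
  by_cases hd : (n : ℤ) ∣ k
  · obtain ⟨l, rfl⟩ := hd
    obtain ⟨h, hh, huh⟩ := coeFn_of_mem_HinfPow hu
    rw [coeff_congr huh, coeff_comp_pow n (Lp.aestronglyMeasurable h)]
    refine hh l ?_
    have : (0 : ℤ) < n := Nat.cast_pos.2 (NeZero.pos n)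
    nlinarith
  · have h1 := coeff_rot u (root n) k
    rw [coeff_congr (ae_rot_root_of_mem_HinfPow hu)] at h1
    have h2 : (root n : ℂ) ^ k ≠ 1 := fun h =>
      hd (((isPrimitiveRoot_root n).zpow_eq_one_iff_dvd k).1 h)
    have h3 : ((root n : ℂ) ^ k - 1) * coeff u k = 0 := by linear_combination -h1
    exact (mul_eq_zero.1 h3).resolve_left (sub_ne_zero.2 h2)

/-- A function invariant under rotation by the `n`-th roots of unity factors through `z ↦ z^n`. -/
lemma exists_comp_pow {n : ℕ} [NeZero n] {G : Circle → ℂ} (hG : Measurable G)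
    (hinv : ∀ z, G (root n * z) = G z) : ∃ h : Circle → ℂ, Measurable h ∧ ∀ z, h (z ^ n) = G z := by
  have hn : (n : ℝ) ≠ 0 := Nat.cast_ne_zero.2 (NeZero.ne n)
  have hpow : ∀ (j : ℕ) (z : Circle), G (root n ^ j * z) = G z := by
    intro j
    induction j with
    | zero => simp
    | succ j ih => intro z; rw [pow_succ', mul_assoc, hinv, ih]
  have harg : Measurable fun z : Circle => Complex.arg z :=
    Complex.measurable_arg.comp
      (by fun_prop : Continuous fun z : Circle => (z : ℂ)).measurable
  -- G is evaluated at a measurable choice of n-th root of w. For w = z^n this root differs from z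
  -- by a power of ω, which G does not see.
  refine ⟨fun w => G (Circle.exp (Complex.arg w / n)),
    hG.comp (Circle.exp.continuous.measurable.comp (harg.div_const _)), fun z => ?_⟩
  set s := Circle.exp (Complex.arg (z ^ n : Circle) / n) with hs
  have hsn : s ^ n = z ^ n := by
    rw [hs, ← Circle.exp_nsmul, nsmul_eq_mul, mul_div_cancel₀ _ hn, Circle.exp_arg]
  have h1 : (((s / z : Circle)) : ℂ) ^ n = 1 := by
    rw [← Circle.coe_pow, div_pow, hsn, div_self', Circle.coe_one]
  obtain ⟨j, -, hj⟩ := (isPrimitiveRoot_root n).eq_pow_of_pow_eq_one h1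
  have h2 : s = root n ^ j * z := by
    rw [← div_eq_iff_eq_mul]
    apply Circle.ext
    rw [← hj, Circle.coe_pow]
  change G s = G z
  rw [h2, hpow]

/-- Only the coefficients of g at negative multiples of n matter, since the l-th coefficient of h in
avg g = h(z^n) sits at nl. This weaker condition is needed because z^{-k} g may have nonzero
coefficients at -k, …, -1. -/
lemma exists_mem_HinfPow_eq_avg (n : ℕ) [NeZero n] {g : Linf}
    (hg : ∀ l : ℤ, l < 0 → coeff g (n * l) = 0) : ∃ u ∈ HinfPow n, (u : L0) = avg n (g : L0) := by
  set G : Circle → ℂ := fun z => (n : ℂ)⁻¹ * ∑ j ∈ Finset.range n, g (root n ^ j * z) with hGdef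
  have hgm : Measurable g := (Lp.stronglyMeasurable g).measurable
  have hGm : Measurable G :=
    (Finset.measurable_fun_sum _ fun j _ => hgm.comp (measurable_const_mul _)).const_mul _
  have hGL : MemLp G ∞ m :=
    (memLp_finsetSum _ fun j _ =>
      (Lp.memLp g).comp_measurePreserving (measurePreserving_mul_left m (root n ^ j))).const_mul _
  have hinv : ∀ z, G (root n * z) = G z := by
    intro z
    -- Rotating by ω shifts the summation index cyclically: the sum over 0 ≤ j ≤ n is split off at
    -- either end, and the two end terms agree since ω^n = 1.
    have h1 := Finset.sum_range_succ (fun j => g (root n ^ j * z)) n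
    rw [Finset.sum_range_succ', root_pow, pow_zero] at h1
    simp only [hGdef]
    rw [← add_right_cancel h1]
    simp only [pow_succ, mul_assoc]
  obtain ⟨h, hhm, hh⟩ := exists_comp_pow hGm hinv
  have hp := measurePreserving_pow n
  have hhL : MemLp h ∞ m := by
    refine ⟨hhm.aestronglyMeasurable, ?_⟩
    -- Since z ↦ z^n preserves m, h has the same essential supremum as G.
    rw [← eLpNorm_comp_measurePreserving hhm.aestronglyMeasurable hp]
    have : h ∘ (fun z : Circle => z ^ n) = G := funext hh
    rw [this]
    exact hGL.2
  refine ⟨_, ⟨hhL.toLp h, fun k hk => ?_, rfl⟩, ?_⟩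
  · have hint : ∀ j : ℕ, Integrable
        (fun z : Circle => g (root n ^ j * z) * (z : ℂ) ^ (-(n * k : ℤ))) m := by
      intro j
      have h1 := (measurePreserving_mul_left m (root n ^ j)).integrable_comp_of_integrable
        ((Lp.memLp g).integrable le_top)
      refine h1.mono (h1.1.mul (continuous_zpow_coe _).aestronglyMeasurable) ?_
      filter_upwards with z
      rw [norm_mul, norm_zpow, Circle.norm_coe, one_zpow, mul_one]
      rfl
    rw [coeff_congr hhL.coeFn_toLp, ← coeff_comp_pow n hhm.aestronglyMeasurable]
    simp only [hh]
    have hzero : ∀ j : ℕ,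
        ∫ z : Circle, g (root n ^ j * z) * (z : ℂ) ^ (-(n * k : ℤ)) ∂m = 0 := by
      intro j
      have h1 := coeff_rot g (root n ^ j) (n * k)
      rw [hg k hk, mul_zero] at h1
      exact h1
    unfold coeff
    simp only [hGdef, mul_assoc, Finset.sum_mul]
    rw [integral_const_mul, integral_finsetSum _ fun j _ => hint j,
      Finset.sum_eq_zero fun j _ => hzero j, mul_zero]
  · apply AEEqFun.ext
    have h1 := Lp.coeFn_compMeasurePreserving (hhL.toLp h) hp
    filter_upwards [h1, hp.quasiMeasurePreserving.ae hhL.coeFn_toLp, coeFn_avg n (g : L0)]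
      with z h2 h3 h4
    rw [h4]
    refine h2.trans (h3.trans (hh z))

/-! ### Passage to α-closures. -/

/-- For u ∈ H^∞(z^n) one has Rf - f = R(f - u) - (f - u), which is α-small by contractivity of R;
definiteness then gives equality. -/
lemma rotL_eq_of_mem_Malpha {α : GaugeNorm} (hrot : α.IsRotSymm) {n : ℕ} [NeZero n] {f : L0}
    (hf : f ∈ Malpha α n) : rotL (root n) f = f := by
  rw [← sub_eq_zero]
  refine eq_zero_of_ext_eq_zero (α := α) (le_antisymm ?_ bot_le)
  refine le_of_forall_gt fun ε hε => ?_
  obtain ⟨u, hu, h⟩ := hf (ε / 2) (ENNReal.half_pos hε.ne')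
  have hru : rotL (root n) (u : L0) = u := by
    apply AEEqFun.ext
    filter_upwards [coeFn_rotL (root n) (u : L0), ae_rot_root_of_mem_HinfPow hu] with z h1 h2
    rw [h1]
    exact h2
  have heq : rotL (root n) f - f = rotL (root n) (f - u) - (f - (u : L0)) := by
    rw [map_sub, hru]
    abel
  rw [heq]
  calc _ ≤ α.ext (rotL (root n) (f - u)) + α.ext (f - u) := ext_sub_le α _ _
    _ ≤ α.ext (f - u) + α.ext (f - u) := by
        gcongr
        exact ext_rotL_le hrot _ _
    _ < ε / 2 + ε / 2 := ENNReal.add_lt_add h h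
    _ = ε := ENNReal.add_halves ε

lemma rotL_zC_mul (w : Circle) (k : ℤ) (f : L0) :
    rotL w (zC k * f) = (w : ℂ) ^ k • (zC k * rotL w f) := by
  apply AEEqFun.ext
  filter_upwards [coeFn_rotL w (zC k * f), ae_rot w (coeFn_zC_mul k f), coeFn_zC_mul k (rotL w f),
    coeFn_rotL w f, AEEqFun.coeFn_smul ((w : ℂ) ^ k) (zC k * rotL w f)] with z h1 h2 h3 h4 h5
  rw [h1, h2, h5, Pi.smul_apply, h3, h4, Circle.coe_mul, mul_zpow, smul_eq_mul, mul_assoc]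

/-- The summands lie in eigenspaces of rotation by ω for the distinct eigenvalues ω^k, 0 ≤ k < n. -/
lemma iSupIndep_map_mulZ {α : GaugeNorm} (hrot : α.IsRotSymm) (n : ℕ) [NeZero n] :
    iSupIndep (fun k : Fin n => (Malpha α n).map (mulZ k)) := by
  have hinj : Function.Injective fun k : Fin n => (root n : ℂ) ^ (k : ℕ) := fun a b h =>
    Fin.ext ((isPrimitiveRoot_root n).pow_inj a.2 b.2 h)
  refine ((Module.End.eigenspaces_iSupIndep (rotL (root n))).comp hinj).mono fun k => ?_
  rintro _ ⟨f, hf, rfl⟩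
  rw [Function.comp_apply, Module.End.mem_eigenspace_iff, mulZ_eq, rotL_zC_mul,
    rotL_eq_of_mem_Malpha hrot hf, zpow_natCast]

lemma mulZ_mem_Halpha {α : GaugeNorm} {n : ℕ} [NeZero n] (k : ℕ) {f : L0} (hf : f ∈ Malpha α n) :
    mulZ k f ∈ Halpha α := by
  intro ε hε
  obtain ⟨u, hu, h⟩ := hf ε hε
  obtain ⟨v, hv, hcoeff⟩ := exists_zC_mul k u
  refine ⟨v, fun i hi => ?_, ?_⟩
  · rw [hcoeff]
    exact HinfPow_le_Hinf n hu _ (by lia)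
  · rw [hv, mulZ_eq, ← zC_mul_sub]
    exact (ext_zC_mul_le α _ _).trans_lt h

lemma avg_zC_mul_mem_Malpha {α : GaugeNorm} (hrot : α.IsRotSymm) {n : ℕ} [NeZero n] {k : ℕ}
    (hk : k < n) {f : L0} (hf : f ∈ Halpha α) : avg n (zC (-k) * f) ∈ Malpha α n := by
  intro ε hε
  obtain ⟨g, hg, h⟩ := hf ε hε
  obtain ⟨v, hv, hcoeff⟩ := exists_zC_mul (-k) g
  obtain ⟨u, hu, huv⟩ := exists_mem_HinfPow_eq_avg n (g := v) fun l hl => by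
    rw [hcoeff]
    refine hg _ ?_
    -- The index here is nl + k, and l ≤ -1 gives nl + k ≤ k - n < 0.
    have : (k : ℤ) < n := by exact_mod_cast hk
    nlinarith
  refine ⟨u, hu, ?_⟩
  rw [huv, hv, ← map_sub, ← zC_mul_sub]
  exact ((ext_avg_le hrot n _).trans (ext_zC_mul_le α _ _)).trans_lt h

end RotHardy
end

/-- `H^α = M_α(z^n) ⊕ z M_α(z^n) ⊕ ⋯ ⊕ z^{n-1} M_α(z^n)` as an internal algebraic direct sum of
complex linear subspaces. -/
theorem lemma4p2 (α : RotHardy.GaugeNorm) (hrot : α.IsRotSymm) (hcont : α.IsCont)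
    (n : ℕ) [NeZero n] :
    iSupIndep (fun k : Fin n => (RotHardy.Malpha α n).map (RotHardy.mulZ k)) ∧
      (⨆ k : Fin n, (RotHardy.Malpha α n).map (RotHardy.mulZ k)) = RotHardy.Halpha α := by
  refine ⟨RotHardy.iSupIndep_map_mulZ hrot n, le_antisymm (iSup_le fun k => ?_) fun f hf => ?_⟩
  · rintro _ ⟨f, hf, rfl⟩
    exact RotHardy.mulZ_mem_Halpha k hf
  · rw [← RotHardy.sum_zC_mul_avg n f]
    refine Submodule.sum_mem _ fun k hk => ?_
    have hk' := Finset.mem_range.1 hk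
    refine Submodule.mem_iSup_of_mem ⟨k, hk'⟩
      ⟨_, RotHardy.avg_zC_mul_mem_Malpha hrot hk' hf, RotHardy.mulZ_eq _ _⟩
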